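/- **Setting.** Fix an infinite set $\mathbb A$ of atoms, a set $\mathbb V$ of variables, and a signature whose term-formers are either free symbols $\mathtt f$ of some arity $n\ge 0$ or commutative symbols $\mathtt f^{C}$ of arity $2$. $\mathrm{Perm}(\mathbb A)$ is the group of bijections $\pi$ of $\mathbb A$ with finite domain $\mathrm{dom}\,\pi=\{a\mid \pi(a)\ne a\}$, and $\mathrm{Perm}(B)=\{\pi\mid \mathrm{dom}\,\pi\subseteq B\}$. Nominal terms are $t::=a\mid \pi\cdot X\mid \mathtt f(t_1,\dots,t_n)\mid \mathtt f^C(t_0,t_1)\mid [a]t$, with the homomorphic permutation action satisfying $\pi\cdot(\pi'\cdot X)\equiv(\pi\circ\pi')\cdot X$ and $\pi\cdot[a]t\equiv[\pi(a)](\pi\cdot t)$. The set $\mathrm{atm}(t)$ consists of all atoms occurring in $t$, with $\mathrm{atm}(\pi\cdot X)=\mathrm{dom}\,\pi$. A substitution $\sigma$ maps variables to terms, with $X\sigma\equiv \mathrm{id}\cdot X$ for all but finitely many $X$, and acts homomorphically, with $(\pi\cdot X)\sigma\equiv\pi\cdot(X\sigma)$; $\sigma_{\vec c}$ is a substitution with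 a finite set $\vec c$ of quantified names. A fixed-point context $\Upsilon_{\vec c}$ is a finite set $\vec c$ of quantified atoms with a finite set $\Upsilon$ of constraints $\pi\curlywedge X$ (meaning $\pi\cdot X\approx_C X$). Write $\pi_{\vec c}$ (resp. $\pi_{\neg\vec c}$) for the product of the disjoint cycles of $\pi$ that mention some (resp. no) atom of $\vec c$. $\Upsilon_{\vec c}$ is in *normal form* if for every $\pi\curlywedge X\in\Upsilon$ one of $\pi_{\vec c},\pi_{\neg\vec c}$ is the identity, and $\mathrm{dom}\,\pi_{\vec c}\cap\mathrm{dom}\,\pi'_{\neg\vec c}=\emptyset$ whenever $\pi\curlywedge X,\ \pi'\curlywedge X\in\Upsilon$. Put $$P(\Upsilon_{\vec c}|_X)=\mathrm{Perm}\Big(\vec c\cup\bigcup_{\pi\curlywedge X\in\Upsilon}\mathrm{dom}\,\pi_{\vec c}\Big)\circ\big\langle \pi_{\neg\vec c}\mid \pi\curlywedge X\in\Upsilon\big\rangle .$$ The judgement $\Upsilon_{\vec c}\vdash s\approx_C t$ is inductively defined by the following rules. (i) $\Upsilon_{\vec c}\vdash a\approx_C a$. (ii) $\Upsilon_{\vec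 c}\vdash\pi\cdot X\approx_C\pi'\cdot X$ if $\pi'^{-1}\circ\pi\in P(\Upsilon_{\vec c}|_X)$. (iii) $\Upsilon_{\vec c}\vdash\mathtt f(t_1,\dots,t_n)\approx_C\mathtt f(t'_1,\dots,t'_n)$ if $\Upsilon_{\vec c}\vdash t_i\approx_C t'_i$ for all $i$. (iv) $\Upsilon_{\vec c}\vdash\mathtt f^C(s_0,s_1)\approx_C\mathtt f^C(t_0,t_1)$ if, for $i=0$ or $i=1$, $\Upsilon_{\vec c}\vdash s_0\approx_C t_i$ and $\Upsilon_{\vec c}\vdash s_1\approx_C t_{1-i}$. (v) $\Upsilon_{\vec c}\vdash[a]t\approx_C[a]t'$ if $\Upsilon_{\vec c}\vdash t\approx_C t'$. (vi) For $a\neq b$, $\Upsilon_{\vec c}\vdash[a]t\approx_C[b]s$ if $\Upsilon_{\vec c\cup\{c_1\}}\vdash(a\ c_1)\cdot t\approx_C(b\ c_1)\cdot s$ for some atom $c_1$ not occurring in $\vec c,\Upsilon,[a]t,[b]s$. **Lemma (Preservation by substitution).** Let $\Upsilon_{\vec c}$ and $\Upsilon'_{\vec c'}$ be contexts and $\sigma_{\vec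 c''}$ a substitution with quantified names, such that the context $\Upsilon_{\vec c\cup\vec c'\cup\vec c''}$ is in normal form and the quantified names $\vec c'$ are fresh for $\sigma$, i.e. $\vec c'\cap\mathrm{atm}(X\sigma)=\emptyset$ for every variable $X$. Suppose $\Upsilon_{\vec c}\vdash\Upsilon'_{\vec c'}\sigma_{\vec c''}$, that is, $$\Upsilon_{\vec c\cup\vec c'\cup\vec c''}\vdash\pi\cdot(X\sigma)\approx_C X\sigma\quad\text{for every }\pi\curlywedge X\in\Upsilon'.$$ Then for all nominal terms $s,t$: if $\Upsilon'_{\vec c'}\vdash s\approx_C t$, then $\Upsilon_{\vec c\cup\vec c'}\vdash s\sigma_{\vec c''}\approx_C t\sigma_{\vec c''}$, that is, $\Upsilon_{\vec c\cup\vec c'\cup\vec c''}\vdash s\sigma\approx_C t\sigma$. -/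

import Mathlib

open scoped Pointwise

namespace NominalC

/-! ### Finite permutations of atoms -/

/-- `dom π`, the set of atoms moved by `π`. -/
def permDom {A : Type*} (π : Equiv.Perm A) : Set A := {a | π a ≠ a}

/-- `Perm(𝔸)`: the group of permutations of the atoms with finite domain. -/
def finPermSubgroup (A : Type*) : Subgroup (Equiv.Perm A) where
  carrier := {π | (permDom π).Finite}
  one_mem' := by simp [permDom]
  mul_mem' := by
    intro π ρ hπ hρ
    refine (Set.Finite.union hπ hρ).subset fun a ha => ?_
    by_contra hn
    simp only [permDom, Set.mem_union, Set.mem_ofPred_eq, not_or, not_not] at ha hn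
    exact ha (by rw [Equiv.Perm.mul_apply, hn.2, hn.1])
  inv_mem' := by
    intro π hπ
    refine Set.Finite.subset hπ fun a ha => ?_
    intro hn
    exact ha (by rw [Equiv.Perm.inv_eq_iff_eq, hn])

/-- Finite permutations of atoms; multiplication is composition. -/
abbrev FinPerm (A : Type*) : Type _ := finPermSubgroup A

namespace FinPerm

/-- The domain of a finite permutation. -/
def dom {A : Type*} (π : FinPerm A) : Set A := permDom (π : Equiv.Perm A)

/-- The swapping `(a b)`. -/
def swap {A : Type*} [DecidableEq A] (a b : A) : FinPerm A :=
  ⟨Equiv.swap a b, by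
    refine Set.Finite.subset (Set.toFinite {a, b}) fun x hx => ?_
    by_contra hn
    simp only [Set.mem_insert_iff, Set.mem_singleton_iff, not_or] at hn
    exact hx (Equiv.swap_apply_of_ne_of_ne hn.1 hn.2)⟩

/-- `Perm(B)`: the finite permutations whose domain is contained in `B`. -/
def permOn {A : Type*} (B : Set A) : Set (FinPerm A) := {π | π.dom ⊆ B}

open Classical in
/-- The permutation that acts as `π` on a set of atoms closed under `π` and `π⁻¹`, and as the
identity elsewhere: the product of those disjoint cycles of `π` that lie in the set. -/
noncomputable def restrict {A : Type*} (π : FinPerm A) (p : A → Prop)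
    (h : ∀ a, p ((π : Equiv.Perm A) a) ↔ p a) : FinPerm A :=
  ⟨Equiv.Perm.ofSubtype ((π : Equiv.Perm A).subtypePerm h), by
    refine Set.Finite.subset π.2 fun a ha => ?_
    intro hn
    apply ha
    by_cases hp : p a
    · rw [Equiv.Perm.ofSubtype_apply_of_mem _ hp]
      exact hn
    · exact Equiv.Perm.ofSubtype_apply_of_not_mem _ hp⟩

/-- The atom `a` lies on a cycle of `π` that mentions an atom of `C`. -/
def MeetsNew {A : Type*} (π : FinPerm A) (C : Finset A) (a : A) : Prop :=
  ∃ c ∈ C, (π : Equiv.Perm A).SameCycle a c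

theorem meetsNew_apply {A : Type*} (π : FinPerm A) (C : Finset A) (a : A) :
    π.MeetsNew C ((π : Equiv.Perm A) a) ↔ π.MeetsNew C a := by
  simp [MeetsNew, Equiv.Perm.sameCycle_apply_left]

/-- `π_C`: the product of the disjoint cycles of `π` that mention an atom of `C`. -/
noncomputable def newPart {A : Type*} (π : FinPerm A) (C : Finset A) : FinPerm A :=
  π.restrict (π.MeetsNew C) (π.meetsNew_apply C)

/-- `π_¬C`: the product of the disjoint cycles of `π` that mention no atom of `C`. -/
noncomputable def nonNewPart {A : Type*} (π : FinPerm A) (C : Finset A) : FinPerm A :=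
  π.restrict (fun a => ¬ π.MeetsNew C a) (fun a => not_congr (π.meetsNew_apply C a))

end FinPerm

/-! ### Nominal terms -/

/-- A signature: term-formers without equational theory, each with an arity, and commutative
term-formers, which are binary. -/
structure Signature where
  /-- term-formers without equational theory -/
  Op : Type*
  /-- their arities -/
  arity : Op → ℕ
  /-- commutative (binary) term-formers -/
  COp : Type*

/-- Nominal terms `a | π·X | f(t₁,…,tₙ) | fᶜ(t₀,t₁) | [a]t` as raw syntax. -/
inductive Term (S : Signature) (A V : Type*) where
  | atom (a : A) : Term S A V
  | susp (π : FinPerm A) (X : V) : Term S A V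
  | app (f : S.Op) (ts : Fin (S.arity f) → Term S A V) : Term S A V
  | capp (f : S.COp) (t₀ t₁ : Term S A V) : Term S A V
  | abs (a : A) (t : Term S A V) : Term S A V

namespace Term

/-- The set of all atoms occurring in a term (in atoms, suspended permutations, abstractions). -/
def atoms {S : Signature} {A V : Type*} : Term S A V → Set A
  | atom a => {a}
  | susp π _ => π.dom
  | app _ ts => ⋃ i, (ts i).atoms
  | capp _ t₀ t₁ => t₀.atoms ∪ t₁.atoms
  | abs a t => insert a t.atoms

/-- The object-level permutation action `π · t`. -/
def perm {S : Signature} {A V : Type*} (π : FinPerm A) : Term S A V → Term S A V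
  | atom a => atom ((π : Equiv.Perm A) a)
  | susp π' X => susp (π * π') X
  | app f ts => app f fun i => (ts i).perm π
  | capp f t₀ t₁ => capp f (t₀.perm π) (t₁.perm π)
  | abs a t => abs ((π : Equiv.Perm A) a) (t.perm π)

/-- The homomorphic action on terms of an assignment of terms to variables. -/
def bind {S : Signature} {A V : Type*} (θ : V → Term S A V) : Term S A V → Term S A V
  | atom a => atom a
  | susp π X => (θ X).perm π
  | app f ts => app f fun i => (ts i).bind θ
  | capp f t₀ t₁ => capp f (t₀.bind θ) (t₁.bind θ)
  | abs a t => abs a (t.bind θ)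

end Term

/-- A substitution with a finite list of new-quantified names: `И c''. σ`, where `σ` differs from
the identity at finitely many variables only. -/
structure NewSubst (S : Signature) (A V : Type*) where
  /-- the new-quantified names -/
  names : Finset A
  /-- the underlying assignment -/
  toFun : V → Term S A V
  finite_dom : {X | toFun X ≠ Term.susp 1 X}.Finite

/-! ### Fixed-point contexts -/

/-- A generalised fixed-point context `И c. Υ`: a finite set `names` of new-quantified atoms and a
finite set of primitive constraints, the pair `(π, X)` standing for `π ⋏ X`, i.e. `π·X ≈ X`. -/
structure FixCtx (A V : Type*) where
  /-- the new-quantified names -/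
  names : Finset A
  /-- the primitive fixed-point constraints -/
  constraints : Set (FinPerm A × V)
  finite_constraints : constraints.Finite

namespace FixCtx

/-- `Υ_{c ∪ D}`: quantify the names in `D` in addition. -/
def addNames {A V : Type*} [DecidableEq A] (Γ : FixCtx A V) (D : Finset A) : FixCtx A V :=
  { Γ with names := Γ.names ∪ D }

/-- All atoms of a context, including vacuously quantified names. -/
def atoms {A V : Type*} (Γ : FixCtx A V) : Set A :=
  (Γ.names : Set A) ∪ ⋃ p ∈ Γ.constraints, p.1.dom

/-- The atoms of the freshness part of `Γ|_X`: all new-quantified names, and the atoms of `π_c` for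
the constraints `π ⋏ X` of `Γ`. -/
def freshAtoms {A V : Type*} (Γ : FixCtx A V) (X : V) : Set A :=
  (Γ.names : Set A) ∪ {a | ∃ π, (π, X) ∈ Γ.constraints ∧ a ∈ (π.newPart Γ.names).dom}

/-- The permutations `π_¬c` for the constraints `π ⋏ X` of `Γ`. -/
def fixPerms {A V : Type*} (Γ : FixCtx A V) (X : V) : Set (FinPerm A) :=
  {ρ | ∃ π, (π, X) ∈ Γ.constraints ∧ ρ = π.nonNewPart Γ.names}

/-- The set `Perm(atm((Γ|_X)_#)) ∘ ⟨perm((Γ|_X)_⋏)⟩` of composites. -/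
def permGroup {A V : Type*} (Γ : FixCtx A V) (X : V) : Set (FinPerm A) :=
  FinPerm.permOn (Γ.freshAtoms X) * (Subgroup.closure (Γ.fixPerms X) : Set (FinPerm A))

/-- Normal form with respect to the two normalisation rules:
no constraint can be split properly into `π_c ⋏ X` and `π_¬c ⋏ X`, and no cycle of some `π'_¬c`
shares an atom with some `π_c` where `π ⋏ X` and `π' ⋏ X` are constraints on the same variable. -/
structure IsNormal {A V : Type*} (Γ : FixCtx A V) : Prop where
  split : ∀ π X, (π, X) ∈ Γ.constraints →
    π.newPart Γ.names = 1 ∨ π.nonNewPart Γ.names = 1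
  disjoint : ∀ π π' X, (π, X) ∈ Γ.constraints → (π', X) ∈ Γ.constraints →
    Disjoint (π.newPart Γ.names).dom (π'.nonNewPart Γ.names).dom

end FixCtx

/-! ### Derivability -/

/-- The judgement `Υ_c ⊢ t ≈ u`. In the rule for two distinct abstracted atoms the additional
quantified name is a new one. -/
inductive Deriv {S : Signature} {A V : Type*} [DecidableEq A] :
    FixCtx A V → Term S A V → Term S A V → Prop
  | atom (Γ : FixCtx A V) (a : A) : Deriv Γ (.atom a) (.atom a)
  | var (Γ : FixCtx A V) (π π' : FinPerm A) (X : V) (h : π'⁻¹ * π ∈ Γ.permGroup X) :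
      Deriv Γ (.susp π X) (.susp π' X)
  | app (Γ : FixCtx A V) (f : S.Op) (ts ts' : Fin (S.arity f) → Term S A V)
      (h : ∀ i, Deriv Γ (ts i) (ts' i)) : Deriv Γ (.app f ts) (.app f ts')
  | capp (Γ : FixCtx A V) (f : S.COp) (s₀ s₁ t₀ t₁ : Term S A V)
      (h₀ : Deriv Γ s₀ t₀) (h₁ : Deriv Γ s₁ t₁) : Deriv Γ (.capp f s₀ s₁) (.capp f t₀ t₁)
  | cappSwap (Γ : FixCtx A V) (f : S.COp) (s₀ s₁ t₀ t₁ : Term S A V)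
      (h₀ : Deriv Γ s₀ t₁) (h₁ : Deriv Γ s₁ t₀) : Deriv Γ (.capp f s₀ s₁) (.capp f t₀ t₁)
  | abs (Γ : FixCtx A V) (a : A) (t t' : Term S A V) (h : Deriv Γ t t') :
      Deriv Γ (.abs a t) (.abs a t')
  | absNe (Γ : FixCtx A V) (a b c₁ : A) (t s : Term S A V) (hab : a ≠ b)
      (hΓ : c₁ ∉ Γ.atoms) (ht : c₁ ∉ (Term.abs a t).atoms) (hs : c₁ ∉ (Term.abs b s).atoms)
      (h : Deriv (Γ.addNames {c₁}) (t.perm (FinPerm.swap a c₁)) (s.perm (FinPerm.swap b c₁))) :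
      Deriv Γ (.abs a t) (.abs b s)

/-- `Υ_c ⊢ sσ_{c''} ≈ tσ_{c''}`, that is, `Υ_{c ∪ c''} ⊢ sσ ≈ tσ`. -/
def DerivSubst {S : Signature} {A V : Type*} [DecidableEq A] (Γ : FixCtx A V)
    (s t : Term S A V) (σ : NewSubst S A V) : Prop :=
  Deriv (Γ.addNames σ.names) (s.bind σ.toFun) (t.bind σ.toFun)

/-- `Υ_c ⊢ Υ'_{c'}σ_{c''}`, that is, `Υ_{c ∪ c' ∪ c''} ⊢ π·(Xσ) ≈ Xσ` for each constraint
`π ⋏ X` of `Υ'`. -/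
def DerivCtxSubst {S : Signature} {A V : Type*} [DecidableEq A] (Γ Γ' : FixCtx A V)
    (σ : NewSubst S A V) : Prop :=
  ∀ π X, (π, X) ∈ Γ'.constraints →
    Deriv ((Γ.addNames Γ'.names).addNames σ.names) ((σ.toFun X).perm π) (σ.toFun X)

end NominalC

/-! Rule (vi) offers a single new name, which is awkward for transitivity and substitution.
`AlphaEq` therefore separates a context into atoms `F X` fresh for `X` and a group `G X` fixing `X`,
and asks for the premise at all but finitely many names. Only `F` grows below an abstraction. By
`Deriv.alphaEq` and `AlphaEq.deriv` both relations agree on contexts.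

In the target context, normal form makes `G X` preserve `F X`, so the composites `Perm(F X) ∘ G X`
form a group; hence `AlphaEq` is symmetric and transitive and preserves freshness.

`AlphaEq.bind` reduces substitution to two facts about u = Xσ: the atoms assumed fresh for X are
fresh for u, and the permutations assumed to fix X fix u. For a constraint π ⋏ X of Υ', the names c'
do not occur in u and are quantified in the target, so they are fresh for u. From π·u ≈ u, freshness
for u is constant along the cycles of π, so all atoms moved by π_c' are fresh for u. Thus π_c'·u ≈
u, and cancelling π_c' leaves π_¬c'·u ≈ u. -/

namespace NominalC

variable {S : Signature} {A V : Type*}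

/-! ### Cycle decomposition relative to a set of names -/

namespace FinPerm

theorem swap_val_apply [DecidableEq A] (a b x : A) : (swap a b).1 x = Equiv.swap a b x := rfl

theorem apply_eq_of_notMem_dom {π : FinPerm A} {a : A} (h : a ∉ π.dom) : π.1 a = a :=
  not_not.1 h

theorem mul_swap [DecidableEq A] (π : FinPerm A) (a b : A) :
    π * swap a b = swap (π.1 a) (π.1 b) * π :=
  Subtype.ext (Equiv.mul_swap_eq_swap_mul π.1 a b)

theorem finite_dom (π : FinPerm A) : π.dom.Finite := π.2

theorem restrict_apply (π : FinPerm A) (p : A → Prop) (h : ∀ a, p (π.1 a) ↔ p a) (a : A)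
    [Decidable (p a)] : (π.restrict p h).1 a = if p a then π.1 a else a := by
  classical
  split_ifs with hp
  · exact Equiv.Perm.ofSubtype_apply_of_mem _ hp
  · exact Equiv.Perm.ofSubtype_apply_of_not_mem _ hp

theorem newPart_apply (π : FinPerm A) (C : Finset A) (a : A) [Decidable (π.MeetsNew C a)] :
    (π.newPart C).1 a = if π.MeetsNew C a then π.1 a else a :=
  restrict_apply _ _ _ _

theorem nonNewPart_apply (π : FinPerm A) (C : Finset A) (a : A) [Decidable (π.MeetsNew C a)] :
    (π.nonNewPart C).1 a = if π.MeetsNew C a then a else π.1 a :=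
  (restrict_apply _ _ _ _).trans (ite_not _ _ _)

theorem newPart_mul_nonNewPart (π : FinPerm A) (C : Finset A) :
    π.newPart C * π.nonNewPart C = π := by
  classical
  refine Subtype.ext (Equiv.ext fun a => ?_)
  change (π.newPart C).1 ((π.nonNewPart C).1 a) = π.1 a
  rw [nonNewPart_apply]
  split_ifs with h
  · rw [newPart_apply, if_pos h]
  · rw [newPart_apply, if_neg (by rwa [meetsNew_apply])]

theorem dom_newPart_subset (π : FinPerm A) (C : Finset A) : (π.newPart C).dom ⊆ π.dom := by
  classical
  intro a ha hn
  refine ha ?_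
  rw [newPart_apply]
  split_ifs
  · exact hn
  · rfl

theorem dom_nonNewPart_subset (π : FinPerm A) (C : Finset A) : (π.nonNewPart C).dom ⊆ π.dom := by
  classical
  intro a ha hn
  refine ha ?_
  rw [nonNewPart_apply]
  split_ifs
  · rfl
  · exact hn

theorem meetsNew_of_mem_dom_newPart {π : FinPerm A} {C : Finset A} {a : A}
    (h : a ∈ (π.newPart C).dom) : π.MeetsNew C a := by
  classical
  by_contra hn
  exact h (by rw [newPart_apply, if_neg hn])

theorem meetsNew_union_singleton [DecidableEq A] {π : FinPerm A} {C : Finset A} {c a : A}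
    (hc : π.1 c = c) (ha : π.1 a ≠ a) : π.MeetsNew (C ∪ {c}) a ↔ π.MeetsNew C a := by
  constructor
  · rintro ⟨d, hd, h⟩
    rcases Finset.mem_union.1 hd with hd | hd
    · exact ⟨d, hd, h⟩
    · rw [Finset.mem_singleton] at hd
      subst hd
      exact absurd (h.symm.apply_eq_self_iff.1 hc) ha
  · rintro ⟨d, hd, h⟩
    exact ⟨d, Finset.mem_union_left _ hd, h⟩

/-- The cycle of a fixed atom is trivial, so quantifying that atom selects no further cycle of `π`.
-/
theorem newPart_union_singleton [DecidableEq A] {π : FinPerm A} (C : Finset A) {c : A}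
    (hc : π.1 c = c) : π.newPart (C ∪ {c}) = π.newPart C := by
  classical
  refine Subtype.ext (Equiv.ext fun a => ?_)
  rw [newPart_apply, newPart_apply]
  by_cases ha : π.1 a = a
  · simp [ha]
  · simp only [meetsNew_union_singleton hc ha]

theorem nonNewPart_union_singleton [DecidableEq A] {π : FinPerm A} (C : Finset A) {c : A}
    (hc : π.1 c = c) : π.nonNewPart (C ∪ {c}) = π.nonNewPart C := by
  have h := newPart_mul_nonNewPart π (C ∪ {c})
  rw [newPart_union_singleton C hc] at h
  exact mul_left_cancel (h.trans (newPart_mul_nonNewPart π C).symm)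

theorem conj_eq_of_forall_mem_dom {ρ π : FinPerm A}
    (h : ∀ a ∈ π.dom, ρ.1 a = a) : ρ * π * ρ⁻¹ = π := by
  rw [mul_inv_eq_iff_eq_mul]
  refine Subtype.ext (Equiv.ext fun a => ?_)
  change ρ.1 (π.1 a) = π.1 (ρ.1 a)
  by_cases ha : a ∈ π.dom
  · rw [h a ha]
    exact h _ fun hn => ha (π.1.injective hn)
  · rw [apply_eq_of_notMem_dom ha]
    by_cases hb : ρ.1 a ∈ π.dom
    · have h1 : ρ.1 a = a := ρ.1.injective (h _ hb)
      rw [h1] at hb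
      exact absurd hb ha
    · exact (apply_eq_of_notMem_dom hb).symm

end FinPerm

/-! ### Permutation, renaming and freshness on terms -/

namespace Term

theorem finite_atoms (t : Term S A V) : t.atoms.Finite := by
  induction t with
  | atom a => exact Set.finite_singleton a
  | susp π X => exact π.2
  | app f ts ih => exact Set.finite_iUnion ih
  | capp f t₀ t₁ ih₀ ih₁ => exact ih₀.union ih₁
  | abs a t ih => exact ih.insert a

theorem perm_perm (π ρ : FinPerm A) (t : Term S A V) : (t.perm ρ).perm π = t.perm (π * ρ) := by
  induction t with
  | atom a => rfl
  | susp τ X => simp only [perm, mul_assoc]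
  | app f ts ih => simp only [perm, ih]
  | capp f t₀ t₁ ih₀ ih₁ => simp only [perm, ih₀, ih₁]
  | abs a t ih => simp only [perm, ih]; rfl

theorem perm_one (t : Term S A V) : t.perm 1 = t := by
  induction t with
  | atom a => rfl
  | susp τ X => simp only [perm, one_mul]
  | app f ts ih => simp only [perm, ih]
  | capp f t₀ t₁ ih₀ ih₁ => simp only [perm, ih₀, ih₁]
  | abs a t ih => simp only [perm, ih]; rfl

theorem perm_inv_perm (π : FinPerm A) (t : Term S A V) : (t.perm π).perm π⁻¹ = t := by
  rw [perm_perm, inv_mul_cancel, perm_one]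

theorem bind_perm (θ : V → Term S A V) (π : FinPerm A) (t : Term S A V) :
    (t.perm π).bind θ = (t.bind θ).perm π := by
  induction t with
  | atom a => rfl
  | susp τ X => simp only [perm, bind, perm_perm]
  | app f ts ih => simp only [perm, bind, ih]
  | capp f t₀ t₁ ih₀ ih₁ => simp only [perm, bind, ih₀, ih₁]
  | abs a t ih => simp only [perm, bind, ih]

theorem atoms_perm_subset (π : FinPerm A) (t : Term S A V) :
    (t.perm π).atoms ⊆ t.atoms ∪ π.dom := by
  have key : ∀ a, π.1 a ∈ ({a} : Set A) ∪ π.dom := fun a =>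
    or_iff_not_imp_left.2 fun h hn => h (π.1.injective hn)
  induction t with
  | atom a => exact Set.singleton_subset_iff.2 (key a)
  | susp τ X =>
    intro a ha
    by_contra hn
    rw [Set.mem_union, not_or] at hn
    refine ha ?_
    change π.1 (τ.1 a) = a
    rw [FinPerm.apply_eq_of_notMem_dom hn.1, FinPerm.apply_eq_of_notMem_dom hn.2]
  | app f ts ih =>
    exact Set.iUnion_subset fun i => (ih i).trans
      (Set.union_subset_union_left _ (Set.subset_iUnion (fun i => (ts i).atoms) i))
  | capp f t₀ t₁ ih₀ ih₁ =>
    exact Set.union_subset (ih₀.trans (Set.union_subset_union_left _ Set.subset_union_left))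
      (ih₁.trans (Set.union_subset_union_left _ Set.subset_union_right))
  | abs a t ih =>
    exact Set.insert_subset ((key a).imp_left fun h => Set.mem_insert_iff.2 (Or.inl h))
      (ih.trans (Set.union_subset_union_left _ (Set.subset_insert _ _)))

/-- Renaming of all atoms of a term, suspended permutations being conjugated. -/
def rename (ρ : FinPerm A) : Term S A V → Term S A V
  | atom a => atom (ρ.1 a)
  | susp π X => susp (ρ * π * ρ⁻¹) X
  | app f ts => app f fun i => (ts i).rename ρ
  | capp f t₀ t₁ => capp f (t₀.rename ρ) (t₁.rename ρ)
  | abs a t => abs (ρ.1 a) (t.rename ρ)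

theorem rename_perm (ρ π : FinPerm A) (t : Term S A V) :
    (t.perm π).rename ρ = (t.rename ρ).perm (ρ * π * ρ⁻¹) := by
  induction t with
  | atom a => simp [perm, rename]
  | susp τ X => simp only [perm, rename]; congr 1; group
  | app f ts ih => simp only [perm, rename, ih]
  | capp f t₀ t₁ ih₀ ih₁ => simp only [perm, rename, ih₀, ih₁]
  | abs a t ih => simp [perm, rename, ih]

theorem rename_perm_swap [DecidableEq A] (ρ : FinPerm A) (a b : A) (t : Term S A V) :
    (t.perm (FinPerm.swap a b)).rename ρ =
      (t.rename ρ).perm (FinPerm.swap (ρ.1 a) (ρ.1 b)) := by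
  rw [rename_perm, FinPerm.mul_swap, mul_inv_cancel_right]

theorem rename_eq_self {ρ : FinPerm A} {t : Term S A V} (h : ∀ a ∈ t.atoms, ρ.1 a = a) :
    t.rename ρ = t := by
  induction t with
  | atom a => exact congrArg atom (h a rfl)
  | susp τ X => exact congrArg (susp · X) (FinPerm.conj_eq_of_forall_mem_dom h)
  | app f ts ih =>
    exact congrArg (app f) (funext fun i => ih i fun a ha => h a (Set.mem_iUnion.2 ⟨i, ha⟩))
  | capp f t₀ t₁ ih₀ ih₁ =>
    simp only [rename, ih₀ fun a ha => h a (Or.inl ha), ih₁ fun a ha => h a (Or.inr ha)]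
  | abs a t ih =>
    simp only [rename, h a (Set.mem_insert _ _), ih fun b hb => h b (Set.mem_insert_of_mem _ hb)]

/-- The atom `a` is fresh for the term, where `F X` is the set of atoms assumed fresh for `X`. -/
def Fresh (F : V → Set A) (a : A) : Term S A V → Prop
  | atom b => a ≠ b
  | susp π X => π⁻¹.1 a ∈ F X
  | app _ ts => ∀ i, (ts i).Fresh F a
  | capp _ t₀ t₁ => t₀.Fresh F a ∧ t₁.Fresh F a
  | abs b t => a = b ∨ t.Fresh F a

theorem fresh_perm (F : V → Set A) (π : FinPerm A) (a : A) (t : Term S A V) :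
    (t.perm π).Fresh F (π.1 a) ↔ t.Fresh F a := by
  induction t with
  | atom b => simp [perm, Fresh]
  | susp τ X => simp [perm, Fresh]
  | app f ts ih => simp only [perm, Fresh, ih]
  | capp f t₀ t₁ ih₀ ih₁ => simp only [perm, Fresh, ih₀, ih₁]
  | abs b t ih => simp [perm, Fresh, ih]

theorem Fresh.mono {F F' : V → Set A} (hF : ∀ X, F X ⊆ F' X) {a : A} {t : Term S A V}
    (h : t.Fresh F a) : t.Fresh F' a := by
  induction t with
  | atom b => exact h
  | susp τ X => exact hF X h
  | app f ts ih => exact fun i => ih i (h i)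
  | capp f t₀ t₁ ih₀ ih₁ => exact ⟨ih₀ h.1, ih₁ h.2⟩
  | abs b t ih => exact h.imp_right ih

theorem fresh_of_notMem_atoms {F : V → Set A} {a : A} (hF : ∀ X, a ∈ F X) {t : Term S A V}
    (h : a ∉ t.atoms) : t.Fresh F a := by
  induction t with
  | atom b => exact h
  | susp τ X =>
    have : τ⁻¹.1 a = a := Equiv.Perm.inv_eq_iff_eq.2 (FinPerm.apply_eq_of_notMem_dom h).symm
    simpa only [Fresh, this] using hF X
  | app f ts ih => exact fun i => ih i fun hi => h (Set.mem_iUnion.2 ⟨i, hi⟩)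
  | capp f t₀ t₁ ih₀ ih₁ => exact ⟨ih₀ fun hi => h (Or.inl hi), ih₁ fun hi => h (Or.inr hi)⟩
  | abs b t ih => exact Or.inr (ih fun hi => h (Set.mem_insert_of_mem _ hi))

/-- A suspended permutation `τ` fixes `c`, since `c` does not occur; so `τ⁻¹ a = c` would force `a =
c`. -/
theorem Fresh.of_insert {F : V → Set A} {a c : A} {t : Term S A V}
    (h : t.Fresh (fun X => insert c (F X)) a) (hac : a ≠ c) (hc : c ∉ t.atoms) :
    t.Fresh F a := by
  induction t with
  | atom b => exact h
  | susp τ X =>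
    refine Set.mem_of_mem_insert_of_ne h fun he => hac ?_
    rw [← FinPerm.apply_eq_of_notMem_dom hc, ← he]
    simp
  | app f ts ih => exact fun i => ih i (h i) fun hi => hc (Set.mem_iUnion.2 ⟨i, hi⟩)
  | capp f t₀ t₁ ih₀ ih₁ =>
    exact ⟨ih₀ h.1 fun hi => hc (Or.inl hi), ih₁ h.2 fun hi => hc (Or.inr hi)⟩
  | abs b t ih => exact h.imp_right fun h => ih h fun hi => hc (Set.mem_insert_of_mem _ hi)

end Term

/-! ### Cofinitely quantified equality -/

/-- The family `F` of sets of fresh atoms with the atom `c` added. -/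
def insertFresh (c : A) (F : V → Set A) : V → Set A := fun X => insert c (F X)

theorem insertFresh_comm (c d : A) (F : V → Set A) :
    insertFresh c (insertFresh d F) = insertFresh d (insertFresh c F) :=
  funext fun X => Set.insert_comm c d (F X)

theorem subset_insertFresh (c : A) (F : V → Set A) (X : V) : F X ⊆ insertFresh c F X :=
  Set.subset_insert _ _

/-- Equality modulo `α` and commutativity, where the atoms in `F X` are fresh for `X` and the
permutations in `G X` fix `X`. The rule for abstractions is cofinitely quantified. -/
inductive AlphaEq [DecidableEq A] (G : V → Subgroup (FinPerm A)) :
    (V → Set A) → Term S A V → Term S A V → Prop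
  | atom (F : V → Set A) (a : A) : AlphaEq G F (.atom a) (.atom a)
  | var (F : V → Set A) (π π' : FinPerm A) (X : V)
      (h : π'⁻¹ * π ∈ FinPerm.permOn (F X) * (G X : Set (FinPerm A))) :
      AlphaEq G F (.susp π X) (.susp π' X)
  | app (F : V → Set A) (f : S.Op) (ts ts' : Fin (S.arity f) → Term S A V)
      (h : ∀ i, AlphaEq G F (ts i) (ts' i)) : AlphaEq G F (.app f ts) (.app f ts')
  | capp (F : V → Set A) (f : S.COp) (s₀ s₁ t₀ t₁ : Term S A V)
      (h₀ : AlphaEq G F s₀ t₀) (h₁ : AlphaEq G F s₁ t₁) :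
      AlphaEq G F (.capp f s₀ s₁) (.capp f t₀ t₁)
  | cappSwap (F : V → Set A) (f : S.COp) (s₀ s₁ t₀ t₁ : Term S A V)
      (h₀ : AlphaEq G F s₀ t₁) (h₁ : AlphaEq G F s₁ t₀) :
      AlphaEq G F (.capp f s₀ s₁) (.capp f t₀ t₁)
  | abs (F : V → Set A) (a b : A) (t s : Term S A V) (L : Set A) (hL : L.Finite)
      (h : ∀ c ∉ L, AlphaEq G (insertFresh c F) (t.perm (FinPerm.swap a c))
        (s.perm (FinPerm.swap b c))) :
      AlphaEq G F (.abs a t) (.abs b s)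

namespace FinPerm

theorem one_mem_permOn (B : Set A) : (1 : FinPerm A) ∈ permOn B := fun _ ha => absurd rfl ha

theorem mul_mem_permOn {B : Set A} {π ρ : FinPerm A} (hπ : π ∈ permOn B) (hρ : ρ ∈ permOn B) :
    π * ρ ∈ permOn B := by
  intro a ha
  by_contra hn
  refine ha ?_
  change π.1 (ρ.1 a) = a
  rw [apply_eq_of_notMem_dom fun h => hn (hρ h), apply_eq_of_notMem_dom fun h => hn (hπ h)]

theorem inv_mem_permOn {B : Set A} {π : FinPerm A} (hπ : π ∈ permOn B) : π⁻¹ ∈ permOn B := by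
  intro a ha
  by_contra hn
  exact ha (Equiv.Perm.inv_eq_iff_eq.2 (apply_eq_of_notMem_dom fun h => hn (hπ h)).symm)

theorem conj_mem_permOn {B B' : Set A} {π ρ : FinPerm A} (hπ : π ∈ permOn B)
    (h : ∀ a ∈ B, ρ.1 a ∈ B') : ρ * π * ρ⁻¹ ∈ permOn B' := by
  intro a ha
  have h1 : ρ⁻¹.1 a ∈ π.dom := by
    intro hn
    refine ha ?_
    change ρ.1 (π.1 (ρ⁻¹.1 a)) = a
    rw [hn]
    exact ρ.1.apply_symm_apply a
  have := h _ (hπ h1)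
  rwa [show ρ.1 (ρ⁻¹.1 a) = a from ρ.1.apply_symm_apply a] at this

theorem apply_mem_of_mem_permOn {B : Set A} {π : FinPerm A} (hπ : π ∈ permOn B) {a : A}
    (ha : a ∈ B) : π.1 a ∈ B := by
  by_cases h : a ∈ π.dom
  · exact hπ fun hn => h (π.1.injective hn)
  · rwa [apply_eq_of_notMem_dom h]

end FinPerm

/-! ### When the composites `Perm(F X) ∘ G X` form a group -/

/-- The permutations in `G X` map atoms in `F X` to atoms in `F X`. -/
def Stabilizes (G : V → Subgroup (FinPerm A)) (F : V → Set A) : Prop :=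
  ∀ X, ∀ g ∈ G X, ∀ a ∈ F X, g.1 a ∈ F X

/-- All permutations in the groups `G X` fix the atoms outside `B`. -/
def SupportedBy (G : V → Subgroup (FinPerm A)) (B : Set A) : Prop :=
  ∀ X, ∀ g ∈ G X, g.dom ⊆ B

variable {G : V → Subgroup (FinPerm A)} {F F' : V → Set A} {B : Set A}

theorem Stabilizes.insertFresh (h : Stabilizes G F) (hB : SupportedBy G B) {c : A} (hc : c ∉ B) :
    Stabilizes G (insertFresh c F) := by
  rintro X g hg a (rfl | ha)
  · rw [FinPerm.apply_eq_of_notMem_dom fun h => hc (hB X g hg h)]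
    exact Set.mem_insert _ _
  · exact Set.mem_insert_of_mem _ (h X g hg a ha)

theorem Stabilizes.inv_mem_mul (h : Stabilizes G F) {X : V} {π : FinPerm A}
    (hπ : π ∈ FinPerm.permOn (F X) * (G X : Set (FinPerm A))) :
    π⁻¹ ∈ FinPerm.permOn (F X) * (G X : Set (FinPerm A)) := by
  obtain ⟨p, hp, g, hg, rfl⟩ := hπ
  refine ⟨g⁻¹ * p⁻¹ * g⁻¹⁻¹, FinPerm.conj_mem_permOn (FinPerm.inv_mem_permOn hp)
    (h X _ (inv_mem hg)), g⁻¹, inv_mem (SetLike.mem_coe.1 hg), ?_⟩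
  simp

/-- Write p g q k = p (g q g⁻¹) (g k); conjugation by g keeps q in `Perm(F X)` because g preserves
`F X`. -/
theorem Stabilizes.mul_mem_mul (h : Stabilizes G F) {X : V} {π ρ : FinPerm A}
    (hπ : π ∈ FinPerm.permOn (F X) * (G X : Set (FinPerm A)))
    (hρ : ρ ∈ FinPerm.permOn (F X) * (G X : Set (FinPerm A))) :
    π * ρ ∈ FinPerm.permOn (F X) * (G X : Set (FinPerm A)) := by
  obtain ⟨p, hp, g, hg, rfl⟩ := hπ
  obtain ⟨q, hq, k, hk, rfl⟩ := hρ
  refine ⟨p * (g * q * g⁻¹), FinPerm.mul_mem_permOn hp (FinPerm.conj_mem_permOn hq (h X _ hg)),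
    g * k, mul_mem (SetLike.mem_coe.1 hg) hk, ?_⟩
  simp [mul_assoc]

theorem Stabilizes.apply_mem (h : Stabilizes G F) {X : V} {π : FinPerm A}
    (hπ : π ∈ FinPerm.permOn (F X) * (G X : Set (FinPerm A))) {a : A} (ha : a ∈ F X) :
    π.1 a ∈ F X := by
  obtain ⟨p, hp, g, hg, rfl⟩ := hπ
  exact FinPerm.apply_mem_of_mem_permOn hp (h X g hg a ha)

/-! ### Equivariance, equivalence and freshness for `AlphaEq` -/

namespace AlphaEq

variable [DecidableEq A] {s t u : Term S A V}

theorem perm (h : AlphaEq G F s t) (ρ : FinPerm A) : AlphaEq G F (s.perm ρ) (t.perm ρ) := by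
  induction h with
  | atom F a => exact .atom F _
  | var F π π' X h => exact .var _ _ _ _ (by simpa [mul_assoc] using h)
  | app F f ts ts' h ih => exact .app _ _ _ _ ih
  | capp F f s₀ s₁ t₀ t₁ h₀ h₁ ih₀ ih₁ => exact .capp _ _ _ _ _ _ ih₀ ih₁
  | cappSwap F f s₀ s₁ t₀ t₁ h₀ h₁ ih₀ ih₁ => exact .cappSwap _ _ _ _ _ _ ih₀ ih₁
  | abs F a b t s L hL h ih =>
    refine .abs _ _ _ _ _ (L ∪ ρ.dom) (hL.union ρ.finite_dom) fun c hc => ?_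
    rw [Set.mem_union, not_or] at hc
    have := ih c hc.1
    -- For `c` outside `dom ρ`, ρ (a c) = (ρ(a) c) ρ.
    rwa [Term.perm_perm, Term.perm_perm, FinPerm.mul_swap, FinPerm.mul_swap,
      FinPerm.apply_eq_of_notMem_dom hc.2, ← Term.perm_perm, ← Term.perm_perm] at this

theorem rename (h : AlphaEq G F s t) (ρ : FinPerm A)
    (hG : ∀ X, ∀ g ∈ G X, ρ * g * ρ⁻¹ ∈ G X) (hF : ∀ X, ∀ a ∈ F X, ρ.1 a ∈ F' X) :
    AlphaEq G F' (s.rename ρ) (t.rename ρ) := by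
  induction h generalizing F' with
  | atom F a => exact .atom _ _
  | var F π π' X h =>
    obtain ⟨p, hp, g, hg, h⟩ := h
    refine .var _ _ _ _ ⟨ρ * p * ρ⁻¹, FinPerm.conj_mem_permOn hp (hF X), _, hG X g hg, ?_⟩
    have : ρ * (p * g) * ρ⁻¹ = ρ * (π'⁻¹ * π) * ρ⁻¹ := by rw [← h]
    simpa [mul_assoc] using this
  | app F f ts ts' h ih => exact .app _ _ _ _ fun i => ih i hF
  | capp F f s₀ s₁ t₀ t₁ h₀ h₁ ih₀ ih₁ => exact .capp _ _ _ _ _ _ (ih₀ hF) (ih₁ hF)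
  | cappSwap F f s₀ s₁ t₀ t₁ h₀ h₁ ih₀ ih₁ => exact .cappSwap _ _ _ _ _ _ (ih₀ hF) (ih₁ hF)
  | abs F a b t s L hL h ih =>
    refine .abs _ _ _ _ _ (ρ.1 '' L) (hL.image _) fun c hc => ?_
    have hc' : ρ⁻¹.1 c ∉ L := fun hn => hc ⟨_, hn, ρ.1.apply_symm_apply c⟩
    have hρ : ρ.1 (ρ⁻¹.1 c) = c := ρ.1.apply_symm_apply c
    have := ih _ hc' (F' := insertFresh c F') ?_
    · rwa [Term.rename_perm_swap, Term.rename_perm_swap, hρ] at this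
    · rintro X x (rfl | hx)
      · exact Or.inl hρ
      · exact Or.inr (hF X x hx)

theorem mono (h : AlphaEq G F s t) (hF : ∀ X, F X ⊆ F' X) : AlphaEq G F' s t := by
  have := h.rename (1 : FinPerm A) (F' := F') (by simp) fun X a ha => hF X ha
  rwa [Term.rename_eq_self fun _ _ => rfl, Term.rename_eq_self fun _ _ => rfl] at this

/-- At a suspension `τ`, the atoms moved by (π'τ)⁻¹πτ are the τ-preimages of those where `π` and
`π'` disagree. -/
theorem perm_of_fresh (t : Term S A V) (π π' : FinPerm A)
    (h : ∀ a, π.1 a ≠ π'.1 a → t.Fresh F a) : AlphaEq G F (t.perm π) (t.perm π') := by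
  induction t generalizing F π π' with
  | atom a =>
    have : π.1 a = π'.1 a := by_contra fun hn => h a hn rfl
    simpa only [Term.perm, this] using AlphaEq.atom F (π'.1 a)
  | susp τ X =>
    refine .var _ _ _ _ ⟨_, fun x hx => ?_, 1, one_mem _, mul_one _⟩
    have := h (τ.1 x) fun hn => hx ?_
    · simpa [Term.Fresh] using this
    · change ((π' * τ)⁻¹).1 (π.1 (τ.1 x)) = x
      rw [hn]
      exact (π' * τ).1.symm_apply_apply x
  | app f ts ih => exact .app _ _ _ _ fun i => ih i _ _ fun a ha => h a ha i
  | capp f t₀ t₁ ih₀ ih₁ =>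
    exact .capp _ _ _ _ _ _ (ih₀ _ _ fun a ha => (h a ha).1) (ih₁ _ _ fun a ha => (h a ha).2)
  | abs b t ih =>
    refine .abs _ _ _ _ _ (π.dom ∪ π'.dom ∪ t.atoms)
      ((π.finite_dom.union π'.finite_dom).union t.finite_atoms) fun c hc => ?_
    simp only [Set.mem_union, not_or] at hc
    obtain ⟨⟨hπ, hπ'⟩, ht⟩ := hc
    rw [Term.perm_perm, Term.perm_perm]
    refine ih _ _ fun a ha => ?_
    change (FinPerm.swap _ _).1 (π.1 a) ≠ (FinPerm.swap _ _).1 (π'.1 a) at ha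
    by_cases hac : a = c
    · subst hac
      exact Term.fresh_of_notMem_atoms (fun X => Set.mem_insert _ _) ht
    -- Both composites send `b` to `c`, so they cannot disagree at `b`.
    have hab : a ≠ b := by
      rintro rfl
      simp [FinPerm.swap_val_apply] at ha
    have key : ∀ ρ : FinPerm A, c ∉ ρ.dom → (FinPerm.swap (ρ.1 b) c).1 (ρ.1 a) = ρ.1 a := by
      intro ρ hρ
      refine Equiv.swap_apply_of_ne_of_ne (ρ.1.injective.ne hab) fun hn => hac ?_
      rw [← FinPerm.apply_eq_of_notMem_dom hρ] at hn
      exact ρ.1.injective hn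
    rw [key π hπ, key π' hπ'] at ha
    exact ((h a ha).resolve_left hab).mono (subset_insertFresh c F)

theorem refl (t : Term S A V) : AlphaEq G F t t := by
  have := perm_of_fresh (G := G) (F := F) t 1 1 fun a ha => absurd rfl ha
  rwa [Term.perm_one] at this

theorem symm (h : AlphaEq G F s t) (hB : SupportedBy G B) (hBf : B.Finite)
    (hs : Stabilizes G F) : AlphaEq G F t s := by
  induction h with
  | atom F a => exact .atom F _
  | var F π π' X h =>
    refine .var _ _ _ _ ?_
    have := hs.inv_mem_mul h
    rwa [mul_inv_rev, inv_inv] at this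
  | app F f ts ts' h ih => exact .app _ _ _ _ fun i => ih i hs
  | capp F f s₀ s₁ t₀ t₁ h₀ h₁ ih₀ ih₁ => exact .capp _ _ _ _ _ _ (ih₀ hs) (ih₁ hs)
  | cappSwap F f s₀ s₁ t₀ t₁ h₀ h₁ ih₀ ih₁ => exact .cappSwap _ _ _ _ _ _ (ih₁ hs) (ih₀ hs)
  | abs F a b t s L hL h ih =>
    refine .abs _ _ _ _ _ (L ∪ B) (hL.union hBf) fun c hc => ?_
    -- Avoiding the support of `G` keeps the enlarged fresh sets stable under `G`.
    rw [Set.mem_union, not_or] at hc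
    exact ih c hc.1 (hs.insertFresh hB hc.2)

theorem trans (h : AlphaEq G F s t) (h' : AlphaEq G F t u) (hB : SupportedBy G B)
    (hBf : B.Finite) (hs : Stabilizes G F) : AlphaEq G F s u := by
  induction h generalizing u with
  | atom F a => exact h'
  | var F π π' X h =>
    cases h' with
    | var _ _ π'' _ h' =>
      refine .var _ _ _ _ ?_
      have := hs.mul_mem_mul h' h
      rwa [mul_assoc, mul_inv_cancel_left] at this
  | app F f ts ts' h ih =>
    cases h' with
    | app _ _ _ us h' => exact .app _ _ _ _ fun i => ih i (h' i) hs
  | capp F f s₀ s₁ t₀ t₁ h₀ h₁ ih₀ ih₁ =>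
    cases h' with
    | capp _ _ _ _ _ _ h₀' h₁' => exact .capp _ _ _ _ _ _ (ih₀ h₀' hs) (ih₁ h₁' hs)
    | cappSwap _ _ _ _ _ _ h₀' h₁' => exact .cappSwap _ _ _ _ _ _ (ih₀ h₀' hs) (ih₁ h₁' hs)
  | cappSwap F f s₀ s₁ t₀ t₁ h₀ h₁ ih₀ ih₁ =>
    cases h' with
    | capp _ _ _ _ _ _ h₀' h₁' => exact .cappSwap _ _ _ _ _ _ (ih₀ h₁' hs) (ih₁ h₀' hs)
    | cappSwap _ _ _ _ _ _ h₀' h₁' => exact .capp _ _ _ _ _ _ (ih₀ h₁' hs) (ih₁ h₀' hs)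
  | abs F a b t s L hL h ih =>
    cases h' with
    | abs _ _ d _ r L' hL' h' =>
      refine .abs _ _ _ _ _ (L ∪ L' ∪ B) ((hL.union hL').union hBf) fun c hc => ?_
      simp only [Set.mem_union, not_or] at hc
      exact ih c hc.1.1 (h' c hc.1.2) (hs.insertFresh hB hc.2)

theorem fresh [Infinite A] (h : AlphaEq G F s t) (hB : SupportedBy G B) (hBf : B.Finite)
    (hs : Stabilizes G F) {a : A} (ha : s.Fresh F a) : t.Fresh F a := by
  induction h generalizing a with
  | atom F b => exact ha
  | var F π π' X h =>
    have := hs.apply_mem h ha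
    simpa [Term.Fresh] using this
  | app F f ts ts' h ih => exact fun i => ih i hs (ha i)
  | capp F f s₀ s₁ t₀ t₁ h₀ h₁ ih₀ ih₁ => exact ⟨ih₀ hs ha.1, ih₁ hs ha.2⟩
  | cappSwap F f s₀ s₁ t₀ t₁ h₀ h₁ ih₀ ih₁ => exact ⟨ih₁ hs ha.2, ih₀ hs ha.1⟩
  | abs F b d t s L hL h ih =>
    obtain ⟨c, hc⟩ := (((hL.union hBf).union (t.finite_atoms.union s.finite_atoms)).union
      (Set.finite_singleton a)).exists_notMem
    simp only [Set.mem_union, not_or, Set.mem_singleton_iff] at hc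
    obtain ⟨⟨⟨hcL, hcB⟩, hct, hcs⟩, hca⟩ := hc
    by_cases had : a = d
    · exact Or.inl had
    -- If `a` is the bound atom, it is the image of `c`, which does not occur in `t`; otherwise the
    -- swap leaves `a` alone.
    have h1 : (t.perm (FinPerm.swap b c)).Fresh (insertFresh c F) a := by
      by_cases hab : a = b
      · subst hab
        have := (Term.fresh_perm _ (FinPerm.swap a c) c t).2
          (Term.fresh_of_notMem_atoms (fun X => Set.mem_insert c (F X)) hct)
        rwa [FinPerm.swap_val_apply, Equiv.swap_apply_right] at this
      · have := (Term.fresh_perm _ (FinPerm.swap b c) a t).2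
          ((ha.resolve_left hab).mono (subset_insertFresh c F))
        rwa [FinPerm.swap_val_apply, Equiv.swap_apply_of_ne_of_ne hab (Ne.symm hca)] at this
    have h2 := ih c hcL (hs.insertFresh hB hcB) h1
    have h3 : (FinPerm.swap d c).1 a = a :=
      Equiv.swap_apply_of_ne_of_ne had (Ne.symm hca)
    rw [← h3, Term.fresh_perm] at h2
    exact Or.inr (h2.of_insert (Ne.symm hca) hcs)

/-- Strengthening: at a variable, p = π'⁻¹ π g⁻¹ and all three factors fix `c`, so `p` never needed
`c` to be fresh. -/
theorem of_insertFresh (hB : SupportedBy G B) {c : A} (hcB : c ∉ B)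
    (h : AlphaEq G (insertFresh c F) s t) (hs : c ∉ s.atoms) (ht : c ∉ t.atoms) :
    AlphaEq G F s t := by
  generalize hF : insertFresh c F = F' at h
  induction h generalizing F with
  | atom F' a => exact .atom _ _
  | var F' π π' X h =>
    subst hF
    obtain ⟨p, hp, g, hg, h⟩ := h
    refine .var _ _ _ _ ⟨p, fun x hx => ?_, g, hg, h⟩
    refine Set.mem_of_mem_insert_of_ne (hp hx) ?_
    rintro rfl
    have hg' : g⁻¹.1 x = x :=
      FinPerm.apply_eq_of_notMem_dom fun hn => hcB (hB X _ (inv_mem (SetLike.mem_coe.1 hg)) hn)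
    have hπ' : π'⁻¹.1 x = x :=
      Equiv.Perm.inv_eq_iff_eq.2 (FinPerm.apply_eq_of_notMem_dom ht).symm
    refine hx ?_
    have hpe : p = π'⁻¹ * π * g⁻¹ := eq_mul_inv_of_mul_eq h
    rw [hpe]
    change π'⁻¹.1 (π.1 (g⁻¹.1 x)) = x
    rw [hg', FinPerm.apply_eq_of_notMem_dom hs, hπ']
  | app F' f ts ts' h ih =>
    exact .app _ _ _ _ fun i => ih i (fun hn => hs (Set.mem_iUnion.2 ⟨i, hn⟩))
      (fun hn => ht (Set.mem_iUnion.2 ⟨i, hn⟩)) hF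
  | capp F' f s₀ s₁ t₀ t₁ h₀ h₁ ih₀ ih₁ =>
    exact .capp _ _ _ _ _ _ (ih₀ (fun hn => hs (Or.inl hn)) (fun hn => ht (Or.inl hn)) hF)
      (ih₁ (fun hn => hs (Or.inr hn)) (fun hn => ht (Or.inr hn)) hF)
  | cappSwap F' f s₀ s₁ t₀ t₁ h₀ h₁ ih₀ ih₁ =>
    exact .cappSwap _ _ _ _ _ _ (ih₀ (fun hn => hs (Or.inl hn)) (fun hn => ht (Or.inr hn)) hF)
      (ih₁ (fun hn => hs (Or.inr hn)) (fun hn => ht (Or.inl hn)) hF)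
  | abs F' a b t s L hL h ih =>
    subst hF
    refine .abs _ _ _ _ _ (insert c L) (hL.insert c) fun d hd => ?_
    rw [Set.mem_insert_iff, not_or] at hd
    have key : ∀ (e : A) (r : Term S A V), c ∉ (Term.abs e r).atoms →
        c ∉ (r.perm (FinPerm.swap e d)).atoms := by
      intro e r hr hn
      rw [Term.atoms, Set.mem_insert_iff, not_or] at hr
      exact (Term.atoms_perm_subset _ _ hn).elim hr.2 fun hn =>
        hn (Equiv.swap_apply_of_ne_of_ne hr.1 (Ne.symm hd.1))
    exact ih d hd.2 (key a t hs) (key b s ht) (insertFresh_comm c d F)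

end AlphaEq

/-! ### Fresh atoms and fixing groups of contexts -/

namespace FixCtx

/-- The group generated by the permutations `π_¬c` for the constraints `π ⋏ X`. -/
def fixGroup (Γ : FixCtx A V) (X : V) : Subgroup (FinPerm A) := Subgroup.closure (Γ.fixPerms X)

theorem finite_atoms (Γ : FixCtx A V) : Γ.atoms.Finite :=
  Γ.names.finite_toSet.union (Γ.finite_constraints.biUnion fun p _ => p.1.finite_dom)

theorem dom_subset_atoms {Γ : FixCtx A V} {π : FinPerm A} {X : V} (h : (π, X) ∈ Γ.constraints) :
    π.dom ⊆ Γ.atoms :=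
  fun _ ha => Or.inr (Set.mem_iUnion₂.2 ⟨(π, X), h, ha⟩)

theorem freshAtoms_subset_atoms (Γ : FixCtx A V) (X : V) : Γ.freshAtoms X ⊆ Γ.atoms := by
  rintro a (ha | ⟨π, hπ, ha⟩)
  · exact Or.inl ha
  · exact dom_subset_atoms hπ (FinPerm.dom_newPart_subset _ _ ha)

theorem supportedBy_fixGroup (Γ : FixCtx A V) : SupportedBy Γ.fixGroup Γ.atoms := by
  intro X g hg
  induction hg using Subgroup.closure_induction with
  | mem g hg =>
    obtain ⟨π, hπ, rfl⟩ := hg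
    exact (FinPerm.dom_nonNewPart_subset _ _).trans (dom_subset_atoms hπ)
  | one => exact FinPerm.one_mem_permOn _
  | mul g k _ _ hg hk => exact FinPerm.mul_mem_permOn hg hk
  | inv g _ hg => exact FinPerm.inv_mem_permOn hg

theorem freshAtoms_addNames [DecidableEq A] {Γ : FixCtx A V} {c : A} (hc : c ∉ Γ.atoms) :
    (Γ.addNames {c}).freshAtoms = insertFresh c Γ.freshAtoms := by
  have key : ∀ {π : FinPerm A} {X : V}, (π, X) ∈ Γ.constraints → π.1 c = c := fun hπ =>
    FinPerm.apply_eq_of_notMem_dom fun h => hc (dom_subset_atoms hπ h)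
  funext X
  ext a
  simp only [freshAtoms, addNames, insertFresh, Set.mem_union, Set.mem_insert_iff,
    Finset.coe_union, Finset.coe_singleton, Set.mem_singleton_iff, Set.mem_ofPred_eq]
  have : (∃ π, (π, X) ∈ Γ.constraints ∧ a ∈ (π.newPart (Γ.names ∪ {c})).dom) ↔
      ∃ π, (π, X) ∈ Γ.constraints ∧ a ∈ (π.newPart Γ.names).dom :=
    exists_congr fun π => and_congr_right fun hπ => by
      rw [FinPerm.newPart_union_singleton _ (key hπ)]
  rw [this]
  tauto

theorem fixGroup_addNames [DecidableEq A] {Γ : FixCtx A V} {c : A} (hc : c ∉ Γ.atoms) :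
    (Γ.addNames {c}).fixGroup = Γ.fixGroup := by
  funext X
  refine congrArg Subgroup.closure (Set.ext fun ρ => ?_)
  refine exists_congr fun π => and_congr_right fun hπ => ?_
  rw [addNames, FinPerm.nonNewPart_union_singleton _ (FinPerm.apply_eq_of_notMem_dom fun h =>
    hc (dom_subset_atoms (Γ := Γ) hπ h))]

/-- The generators π_¬c even fix every fresh atom: a quantified name lies on a cycle that π_¬c
omits, and the atoms of the π'_c are excluded by disjointness. -/
theorem IsNormal.stabilizes {Γ : FixCtx A V} (h : Γ.IsNormal) :
    Stabilizes Γ.fixGroup Γ.freshAtoms := by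
  have key : ∀ X, ∀ g ∈ Γ.fixGroup X, ∀ a ∈ Γ.freshAtoms X, g.1 a = a := by
    intro X g hg
    induction hg using Subgroup.closure_induction with
    | mem g hg =>
      obtain ⟨π, hπ, rfl⟩ := hg
      rintro a (ha | ⟨π', hπ', ha⟩)
      · classical
        rw [FinPerm.nonNewPart_apply, if_pos ⟨a, ha, Equiv.Perm.SameCycle.refl _ _⟩]
      · exact FinPerm.apply_eq_of_notMem_dom
          (Set.disjoint_left.1 (h.disjoint π' π X hπ' hπ) ha)
    | one => exact fun _ _ => rfl
    | mul g k _ _ hg hk =>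
      intro a ha
      change g.1 (k.1 a) = a
      rw [hk a ha, hg a ha]
    | inv g _ hg => exact fun a ha => Equiv.Perm.inv_eq_iff_eq.2 (hg a ha).symm
  intro X g hg a ha
  rwa [key X g hg a ha]

end FixCtx

/-! ### Translation between `Deriv` and `AlphaEq` -/

theorem finite_iUnion_atoms {θ : V → Term S A V} (hθ : {X | θ X ≠ Term.susp 1 X}.Finite) :
    (⋃ X, (θ X).atoms).Finite := by
  refine (hθ.biUnion fun X _ => (θ X).finite_atoms).subset (Set.iUnion_subset fun X a ha => ?_)
  refine Set.mem_iUnion₂.2 ⟨X, fun hX => ?_, ha⟩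
  rw [hX] at ha
  exact ha rfl

variable [DecidableEq A] {Γ : FixCtx A V} {G G' : V → Subgroup (FinPerm A)} {F F' : V → Set A}
  {B : Set A} {s t u : Term S A V}

theorem Term.rename_swap_perm_swap {a c d : A} {t : Term S A V} (hc : c ∉ (Term.abs a t).atoms)
    (hd : d ∉ (Term.abs a t).atoms) :
    (t.perm (FinPerm.swap a c)).rename (FinPerm.swap c d) = t.perm (FinPerm.swap a d) := by
  rw [Term.atoms, Set.mem_insert_iff, not_or] at hc hd
  rw [Term.rename_perm_swap, Term.rename_eq_self, FinPerm.swap_val_apply, FinPerm.swap_val_apply,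
    Equiv.swap_apply_left, Equiv.swap_apply_of_ne_of_ne (Ne.symm hc.1) (Ne.symm hd.1)]
  intro x hx
  exact Equiv.swap_apply_of_ne_of_ne (fun h => hc.2 (h ▸ hx)) fun h => hd.2 (h ▸ hx)

theorem Deriv.alphaEq (h : Deriv Γ s t) : AlphaEq Γ.fixGroup Γ.freshAtoms s t := by
  induction h with
  | atom Γ a => exact .atom _ _
  | var Γ π π' X h => exact .var _ _ _ _ h
  | app Γ f ts ts' h ih => exact .app _ _ _ _ ih
  | capp Γ f s₀ s₁ t₀ t₁ h₀ h₁ ih₀ ih₁ => exact .capp _ _ _ _ _ _ ih₀ ih₁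
  | cappSwap Γ f s₀ s₁ t₀ t₁ h₀ h₁ ih₀ ih₁ => exact .cappSwap _ _ _ _ _ _ ih₀ ih₁
  | abs Γ a t t' h ih =>
    exact .abs _ _ _ _ _ ∅ Set.finite_empty fun c _ => (ih.perm _).mono (subset_insertFresh c _)
  | absNe Γ a b c t s hab hΓ ht hs h ih =>
    rw [FixCtx.freshAtoms_addNames hΓ, FixCtx.fixGroup_addNames hΓ] at ih
    refine .abs _ _ _ _ _ (Γ.atoms ∪ (Term.abs a t).atoms ∪ (Term.abs b s).atoms)
      ((Γ.finite_atoms.union (Term.finite_atoms _)).union (Term.finite_atoms _)) fun d hd => ?_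
    simp only [Set.mem_union, not_or] at hd
    -- The swap (c d) touches no atom of the context, so renaming by it turns the premise for `c`
    -- into the premise for `d`.
    have hfix : ∀ x ∈ Γ.atoms, (FinPerm.swap c d).1 x = x := fun x hx =>
      Equiv.swap_apply_of_ne_of_ne (fun h => hΓ (h ▸ hx)) fun h => hd.1.1 (h ▸ hx)
    have := ih.rename (FinPerm.swap c d) (F' := insertFresh d Γ.freshAtoms) ?_ ?_
    · rwa [Term.rename_swap_perm_swap ht hd.1.2, Term.rename_swap_perm_swap hs hd.2] at this
    · intro X g hg
      rwa [FinPerm.conj_eq_of_forall_mem_dom fun x hx =>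
        hfix x (Γ.supportedBy_fixGroup X g hg hx)]
    · rintro X x (rfl | hx)
      · exact Or.inl (Equiv.swap_apply_left _ _)
      · rw [hfix x (Γ.freshAtoms_subset_atoms X hx)]
        exact Or.inr hx

/-- Rule (vi) passes to (a c)·s, which is not a subterm; carrying an arbitrary `π` makes structural
induction on `s` applicable. -/
theorem AlphaEq.deriv_perm [Infinite A] (s : Term S A V) (π : FinPerm A)
    (h : AlphaEq Γ.fixGroup Γ.freshAtoms (s.perm π) t) : Deriv Γ (s.perm π) t := by
  induction s generalizing Γ π t with
  | atom a => cases h; exact .atom _ _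
  | susp τ X =>
    cases h with
    | var _ _ π' _ h => exact .var _ _ _ _ h
  | app f ts ih =>
    cases h with
    | app _ _ _ ts' h => exact .app _ _ _ _ fun i => ih i _ (h i)
  | capp f s₀ s₁ ih₀ ih₁ =>
    cases h with
    | capp _ _ _ _ _ _ h₀ h₁ => exact .capp _ _ _ _ _ _ (ih₀ _ h₀) (ih₁ _ h₁)
    | cappSwap _ _ _ _ _ _ h₀ h₁ => exact .cappSwap _ _ _ _ _ _ (ih₀ _ h₀) (ih₁ _ h₁)
  | abs a s ih =>
    cases h with
    | abs _ _ b _ t L hL h =>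
      obtain ⟨c, hc⟩ := (hL.union (Γ.finite_atoms.union
        ((Term.finite_atoms ((Term.abs a s).perm π)).union
          (Term.finite_atoms (Term.abs b t))))).exists_notMem
      simp only [Set.mem_union, not_or] at hc
      obtain ⟨hcL, hcΓ, hcs, hct⟩ := hc
      have hc := h c hcL
      by_cases hab : π.1 a = b
      · subst hab
        refine .abs _ _ _ _ (ih _ ?_)
        -- With equal binders, rule (v) allows no extra name: undo the common swap and discard `c`.
        refine .of_insertFresh Γ.supportedBy_fixGroup hcΓ ?_
          (fun hn => hcs (Set.mem_insert_of_mem _ hn)) fun hn => hct (Set.mem_insert_of_mem _ hn)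
        have := hc.perm (FinPerm.swap (π.1 a) c)⁻¹
        rwa [Term.perm_inv_perm, Term.perm_inv_perm] at this
      · refine .absNe _ _ _ c _ _ hab hcΓ hcs hct ?_
        rw [Term.perm_perm] at hc ⊢
        refine ih _ ?_
        rwa [FixCtx.freshAtoms_addNames hcΓ, FixCtx.fixGroup_addNames hcΓ]

theorem AlphaEq.deriv [Infinite A] (h : AlphaEq Γ.fixGroup Γ.freshAtoms s t) : Deriv Γ s t := by
  rw [← s.perm_one] at h ⊢
  exact h.deriv_perm

/-! ### Substitution -/

theorem AlphaEq.bind (h : AlphaEq G' F' s t) {θ : V → Term S A V}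
    (hθ : {X | θ X ≠ Term.susp 1 X}.Finite) (hB : SupportedBy G B) (hBf : B.Finite)
    (hs : Stabilizes G F) (hF : ∀ X, ∀ a ∈ F' X, (θ X).Fresh F a)
    (hG : ∀ X, ∀ g ∈ G' X, AlphaEq G F ((θ X).perm g) (θ X)) :
    AlphaEq G F (s.bind θ) (t.bind θ) := by
  induction h generalizing F with
  | atom F' a => exact .atom _ _
  | var F' π π' X h =>
    obtain ⟨p, hp, g, hg, h⟩ := h
    have hπ : π = π' * p * g := by
      rw [mul_assoc, show p * g = π'⁻¹ * π from h, mul_inv_cancel_left]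
    have h1 : AlphaEq G F ((θ X).perm p) (θ X) := by
      have := AlphaEq.perm_of_fresh (G := G) (F := F) (θ X) p 1 fun a ha => hF X a (hp ha)
      rwa [Term.perm_one] at this
    -- With π = π' p g and u = θ X: p·(g·u) ≈ p·u ≈ u, then apply π'.
    have h2 := (((hG X g hg).perm p).trans h1 hB hBf hs).perm π'
    rwa [Term.perm_perm, Term.perm_perm, ← hπ] at h2
  | app F' f ts ts' h ih => exact .app _ _ _ _ fun i => ih i hs hF hG
  | capp F' f s₀ s₁ t₀ t₁ h₀ h₁ ih₀ ih₁ =>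
    exact .capp _ _ _ _ _ _ (ih₀ hs hF hG) (ih₁ hs hF hG)
  | cappSwap F' f s₀ s₁ t₀ t₁ h₀ h₁ ih₀ ih₁ =>
    exact .cappSwap _ _ _ _ _ _ (ih₀ hs hF hG) (ih₁ hs hF hG)
  | abs F' a b t s L hL h ih =>
    refine .abs _ _ _ _ _ (L ∪ B ∪ ⋃ X, (θ X).atoms)
      ((hL.union hBf).union (finite_iUnion_atoms hθ)) fun c hc => ?_
    simp only [Set.mem_union, not_or] at hc
    have := ih c hc.1.1 (hs.insertFresh hB hc.1.2) ?_
      fun X g hg => (hG X g hg).mono (subset_insertFresh c F)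
    · rwa [Term.bind_perm, Term.bind_perm] at this
    · rintro X x (rfl | hx)
      · exact Term.fresh_of_notMem_atoms (fun X => Set.mem_insert x (F X)) fun hn =>
          hc.2 (Set.mem_iUnion.2 ⟨X, hn⟩)
      · exact (hF X x hx).mono (subset_insertFresh c F)

/-- `π a` is fresh for π·u exactly when `a` is fresh for u, and π·u ≈ u transfers freshness both
ways; iterate along the cycle. -/
theorem AlphaEq.fresh_iff_of_sameCycle [Infinite A] {π : FinPerm A}
    (h : AlphaEq G F (u.perm π) u) (hB : SupportedBy G B) (hBf : B.Finite)
    (hs : Stabilizes G F) {a b : A} (hab : π.1.SameCycle a b) : u.Fresh F a ↔ u.Fresh F b := by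
  have key : ∀ a, u.Fresh F (π.1 a) ↔ u.Fresh F a := fun a => by
    rw [← Term.fresh_perm F π a u]
    exact ⟨(h.symm hB hBf hs).fresh hB hBf hs, h.fresh hB hBf hs⟩
  obtain ⟨i, rfl⟩ := hab
  induction i using Int.induction_on with
  | zero => rfl
  | succ i ih =>
    refine ih.trans ?_
    rw [add_comm, zpow_add, zpow_one, Equiv.Perm.mul_apply, key]
  | pred i ih =>
    refine ih.trans ?_
    rw [← key ((π.1 ^ (-(i : ℤ) - 1)) a), ← Equiv.Perm.mul_apply, ← zpow_one_add]
    simp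

theorem AlphaEq.perm_of_mem_closure {T : Set (FinPerm A)}
    (h : ∀ g ∈ T, AlphaEq G F (u.perm g) u) (hB : SupportedBy G B) (hBf : B.Finite)
    (hs : Stabilizes G F) {g : FinPerm A} (hg : g ∈ Subgroup.closure T) :
    AlphaEq G F (u.perm g) u := by
  induction hg using Subgroup.closure_induction with
  | mem g hg => exact h g hg
  | one => rw [Term.perm_one]; exact .refl u
  | mul g k _ _ hg hk =>
    rw [← Term.perm_perm]
    exact (hk.perm g).trans hg hB hBf hs
  | inv g _ hg =>
    have := (hg.symm hB hBf hs).perm g⁻¹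
    rwa [Term.perm_inv_perm] at this

/-- If a constraint `π` is satisfied by a term for which the names `C` are fresh, then the atoms of
`π_C` are fresh for the term. -/
theorem AlphaEq.fresh_of_mem_dom_newPart [Infinite A] {π : FinPerm A} {C : Finset A}
    (h : AlphaEq G F (u.perm π) u) (hB : SupportedBy G B) (hBf : B.Finite) (hs : Stabilizes G F)
    (hC : ∀ c ∈ C, u.Fresh F c) {a : A} (ha : a ∈ (π.newPart C).dom) : u.Fresh F a := by
  obtain ⟨c, hc, hac⟩ := FinPerm.meetsNew_of_mem_dom_newPart ha
  exact (h.fresh_iff_of_sameCycle hB hBf hs hac).2 (hC c hc)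

theorem AlphaEq.perm_nonNewPart [Infinite A] {π : FinPerm A} {C : Finset A}
    (h : AlphaEq G F (u.perm π) u) (hB : SupportedBy G B) (hBf : B.Finite) (hs : Stabilizes G F)
    (hC : ∀ c ∈ C, u.Fresh F c) : AlphaEq G F (u.perm (π.nonNewPart C)) u := by
  have h1 : AlphaEq G F (u.perm (π.newPart C)) u := by
    have := AlphaEq.perm_of_fresh (G := G) (F := F) u (π.newPart C) 1 fun a ha =>
      h.fresh_of_mem_dom_newPart hB hBf hs hC ha
    rwa [Term.perm_one] at this
  -- Here π·u ≈ u ≈ π_C·u; applying π_C⁻¹ leaves π_¬C·u ≈ u.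
  have h2 := (h.trans (h1.symm hB hBf hs) hB hBf hs).perm (π.newPart C)⁻¹
  rwa [Term.perm_inv_perm, Term.perm_perm,
    ← eq_inv_mul_of_mul_eq (FinPerm.newPart_mul_nonNewPart π C)] at h2

end NominalC

theorem mainTheorem8 {S : NominalC.Signature} {A V : Type*} [DecidableEq A] [Infinite A]
    (Γ Γ' : NominalC.FixCtx A V) (σ : NominalC.NewSubst S A V)
    (hnormal : ((Γ.addNames Γ'.names).addNames σ.names).IsNormal)
    (hfresh : ∀ X, Disjoint (Γ'.names : Set A) (σ.toFun X).atoms)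
    (hσ : NominalC.DerivCtxSubst Γ Γ' σ)
    (s t : NominalC.Term S A V) (hst : NominalC.Deriv Γ' s t) :
    NominalC.DerivSubst (Γ.addNames Γ'.names) s t σ := by
  have hB := ((Γ.addNames Γ'.names).addNames σ.names).supportedBy_fixGroup
  have hBf := ((Γ.addNames Γ'.names).addNames σ.names).finite_atoms
  have hC : ∀ X, ∀ c ∈ Γ'.names,
      (σ.toFun X).Fresh ((Γ.addNames Γ'.names).addNames σ.names).freshAtoms c := by
    intro X c hc
    refine NominalC.Term.fresh_of_notMem_atoms (fun Y => ?_)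
      (Set.disjoint_left.1 (hfresh X) hc)
    exact Or.inl (Finset.mem_union_left _ (Finset.mem_union_right _ hc))
  refine (hst.alphaEq.bind σ.finite_dom hB hBf hnormal.stabilizes ?_ ?_).deriv
  · rintro X a (ha | ⟨π, hπ, ha⟩)
    · exact hC X a ha
    · exact (hσ π X hπ).alphaEq.fresh_of_mem_dom_newPart hB hBf hnormal.stabilizes (hC X) ha
  · intro X g hg
    refine NominalC.AlphaEq.perm_of_mem_closure ?_ hB hBf hnormal.stabilizes hg
    rintro _ ⟨π, hπ, rfl⟩
    exact (hσ π X hπ).alphaEq.perm_nonNewPart hB hBf hnormal.stabilizes (hC X)
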